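/- Let $\mathbb K$ be a field and let $t\ge 2$ be an integer. Let $G_t$ be the graph with vertices $x_1,x_2,y_1,\dots,y_t,z_1,z_2,w_1,w_2$ and edges $a_i=\{x_1,y_i\}$ and $b_i=\{x_2,y_i\}$ for $1\le i\le t$, $e_1=\{x_1,z_1\}$, $e_2=\{z_1,z_2\}$, $e_3=\{z_2,x_1\}$, $f_1=\{x_2,w_1\}$, $f_2=\{w_1,w_2\}$, $f_3=\{w_2,x_2\}$. Let $\mathbb K[E_t]$ be the polynomial ring whose variables are the edges of $G_t$, and let $I_{G_t}\subseteq\mathbb K[E_t]$ be the toric ideal of $G_t$, that is, the kernel of the $\mathbb K$-algebra homomorphism from $\mathbb K[E_t]$ to the polynomial ring in the vertices that sends each edge $\{v,w\}$ to $vw$. Call a binomial $m_1-m_2\in I_{G_t}$ (a difference of two distinct monomials) primitive if there is no other binomial $m_1'-m_2'\in I_{G_t}$ with $m_1'\mid m_1$ and $m_2'\mid m_2$. Put $\mathcal G=\mathcal G_1\cup\mathcal G_2\cup\mathcal G_3$, where $$\mathcal G_1=\{a_ib_j-a_jb_i \mid 1\le i<j\le t\},$$ $$\mathcal G_2=\{a_ia_jf_1f_3e_2-f_2e_1e_3b_ib_j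 \mid 1\le i<j\le t\},$$ $$\mathcal G_3=\{a_i^2f_1f_3e_2-f_2e_1e_3b_i^2 \mid 1\le i\le t\}.$$ Then the ideal $I_{G_t}$ is generated by $\mathcal G$; up to sign, the primitive binomials of $I_{G_t}$ are exactly the elements of $\mathcal G$; and $\mathcal G$ is a universal Gröbner basis of $I_{G_t}$, that is, a Gröbner basis with respect to every monomial order. -/

import Mathlib

open MvPolynomial

noncomputable section

namespace ToricGraph

section General

universe w

variable {V : Type*} {σ : Type*} (K : Type*) [Field K]

/-- The homomorphism `K[E] → K[V]` that sends the variable of an edge `{v, w}` to `v * w`. -/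
def edgeMap (G : SimpleGraph V) : MvPolynomial G.edgeSet K →ₐ[K] MvPolynomial V K :=
  aeval fun e => (e.1.map (X : V → MvPolynomial V K)).mul

/-- The toric ideal `I_G` of the graph `G`, an ideal of `K[E]`. -/
def toricIdeal (G : SimpleGraph V) : Ideal (MvPolynomial G.edgeSet K) :=
  RingHom.ker (edgeMap K G)

variable {K}

/-- `f` is a primitive binomial of `I`: it is a difference of two distinct monomials, it lies
in `I`, and there is no other binomial `g₁ - g₂ ∈ I` with `g₁ ∣ f₁` and `g₂ ∣ f₂`. -/
def IsPrimitiveBinomial (I : Ideal (MvPolynomial σ K)) (f : MvPolynomial σ K) : Prop :=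
  ∃ u v : σ →₀ ℕ, u ≠ v ∧ f = monomial u 1 - monomial v 1 ∧ f ∈ I ∧
    ∀ u' v' : σ →₀ ℕ, u' ≠ v' →
      (monomial u' 1 - monomial v' 1 : MvPolynomial σ K) ∈ I →
      (monomial u' 1 : MvPolynomial σ K) ∣ monomial u 1 →
      (monomial v' 1 : MvPolynomial σ K) ∣ monomial v 1 →
      u' = u ∧ v' = v

/-- The initial ideal of `I` with respect to the monomial order `m`. -/
def initialIdeal (m : MonomialOrder σ) (I : Ideal (MvPolynomial σ K)) :
    Ideal (MvPolynomial σ K) :=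
  Ideal.span (m.leadingTerm '' (I : Set (MvPolynomial σ K)))

/-- `B` is a Gröbner basis of `I` with respect to `m`: a finite subset of `I` whose leading terms
generate the initial ideal of `I`. -/
def IsGroebnerBasis (m : MonomialOrder σ) (B : Set (MvPolynomial σ K))
    (I : Ideal (MvPolynomial σ K)) : Prop :=
  B.Finite ∧ B ⊆ (I : Set (MvPolynomial σ K)) ∧
    initialIdeal m I = Ideal.span (m.leadingTerm '' B)

/-- `B` is a Gröbner basis of `I` with respect to every monomial order. -/
def IsUniversalGroebnerBasis (B : Set (MvPolynomial σ K)) (I : Ideal (MvPolynomial σ K)) : Prop :=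
  ∀ m : MonomialOrder.{_, w} σ, IsGroebnerBasis m B I

end General

/-- The vertices `x₁, x₂, y₁, …, y_t, z₁, z₂, w₁, w₂`. -/
inductive Vert (t : ℕ) : Type
  | x₁ : Vert t
  | x₂ : Vert t
  | y (i : Fin t) : Vert t
  | z₁ : Vert t
  | z₂ : Vert t
  | w₁ : Vert t
  | w₂ : Vert t

open Vert

/-- The edges of `G_t`: those of the complete bipartite graph between `{x₁, x₂}` and
`{y₁, …, y_t}`, those of the triangle `x₁ z₁ z₂` and those of the triangle `x₂ w₁ w₂`. -/
def edges (t : ℕ) : Set (Sym2 (Vert t)) :=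
  (Set.range fun i => s(x₁, y i)) ∪ (Set.range fun i => s(x₂, y i)) ∪
    {s(x₁, z₁), s(z₁, z₂), s(z₂, x₁)} ∪ {s(x₂, w₁), s(w₁, w₂), s(w₂, x₂)}

/-- The graph `G_t`. -/
def graphG (t : ℕ) : SimpleGraph (Vert t) :=
  SimpleGraph.fromEdgeSet (edges t)

/-- `fromEdgeSet` removes loops; there are none to remove. -/
theorem edgeSet_graphG (t : ℕ) : (graphG t).edgeSet = edges t := by
  rw [graphG, SimpleGraph.edgeSet_fromEdgeSet, sdiff_eq_left, Set.disjoint_left]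
  rintro e he
  simp only [edges, Set.mem_union, Set.mem_range, Set.mem_insert_iff,
    Set.mem_singleton_iff] at he
  rcases he with ((⟨i, rfl⟩ | ⟨i, rfl⟩) | rfl | rfl | rfl) | rfl | rfl | rfl <;> simp

section Variables

variable (K : Type*) [Field K] {t : ℕ}

/-- The variable of an edge of `G_t`. -/
def edgeVar (e : Sym2 (Vert t)) (he : e ∈ edges t) : MvPolynomial (graphG t).edgeSet K :=
  X ⟨e, (edgeSet_graphG t).symm ▸ he⟩

def a (i : Fin t) : MvPolynomial (graphG t).edgeSet K := edgeVar K s(x₁, y i) (by simp [edges])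
def b (i : Fin t) : MvPolynomial (graphG t).edgeSet K := edgeVar K s(x₂, y i) (by simp [edges])
def e₁ : MvPolynomial (graphG t).edgeSet K := edgeVar K s(x₁, z₁) (by simp [edges])
def e₂ : MvPolynomial (graphG t).edgeSet K := edgeVar K s(z₁, z₂) (by simp [edges])
def e₃ : MvPolynomial (graphG t).edgeSet K := edgeVar K s(z₂, x₁) (by simp [edges])
def f₁ : MvPolynomial (graphG t).edgeSet K := edgeVar K s(x₂, w₁) (by simp [edges])
def f₂ : MvPolynomial (graphG t).edgeSet K := edgeVar K s(w₁, w₂) (by simp [edges])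
def f₃ : MvPolynomial (graphG t).edgeSet K := edgeVar K s(w₂, x₂) (by simp [edges])

variable (t)

/-- The binomials `a_i b_j - a_j b_i` with `i < j`. -/
def family₁ : Set (MvPolynomial (graphG t).edgeSet K) :=
  {p | ∃ i j : Fin t, i < j ∧ p = a K i * b K j - a K j * b K i}

/-- The binomials `a_i a_j f₁ f₃ e₂ - f₂ e₁ e₃ b_i b_j` with `i < j`. -/
def family₂ : Set (MvPolynomial (graphG t).edgeSet K) :=
  {p | ∃ i j : Fin t, i < j ∧
    p = a K i * a K j * f₁ K * f₃ K * e₂ K - f₂ K * e₁ K * e₃ K * b K i * b K j}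

/-- The binomials `a_i² f₁ f₃ e₂ - f₂ e₁ e₃ b_i²`. -/
def family₃ : Set (MvPolynomial (graphG t).edgeSet K) :=
  {p | ∃ i : Fin t,
    p = a K i ^ 2 * f₁ K * f₃ K * e₂ K - f₂ K * e₁ K * e₃ K * b K i ^ 2}

/-- The union of the three families. -/
def family : Set (MvPolynomial (graphG t).edgeSet K) :=
  family₁ K t ∪ family₂ K t ∪ family₃ K t

end Variables

end ToricGraph

end

noncomputable section

namespace ToricGraph

/-! ### Binomials in the toric ideal of an arbitrary graph. -/

section General

universe w

variable {V : Type*} {K : Type*} [Field K]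

/-! All three claims follow from one property, `IsConformal`: every pair of distinct exponents `u`,
`v` of equal multidegree has a pair `p ≤ u`, `q ≤ v` coming, up to sign, from the family. Removing
`p` and `q` and inducting on total degree yields generation; for any monomial order, the same
descent reaches a pair oriented like `u`, `v`, whose leading monomial divides that of `u`. For a
primitive binomial the pair below it must be the binomial itself.

`isConformal_family` compares the `a`-exponents of `u` and `v`. If neither dominates, opposite
excesses at two indices give a quadric, since the degree at each `y i` reverses the excess for `b`.
If `u` dominates, let `δ` be its excess in `e₂`. The triangle vertices force excess `-δ` in `e₁` and
`e₃`, so the degree at `x₁` makes the total excess in the `a`'s `2δ`. Either `δ = 0` and `u = v`, or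
`δ ≥ 1`; the degrees at `x₂`, `w₁`, `w₂` then give excess `δ` in `f₁`, `f₃` and `-δ` in `f₂`, and a
binomial of degree five fits below. The same equations show that every member of the family is
primitive. -/

/-- The exponent of the monomial `v * w` attached to an edge `{v, w}`. -/
def edgeWeight : Sym2 V → V →₀ ℕ :=
  Sym2.lift ⟨fun v w => Finsupp.single v 1 + Finsupp.single w 1, fun _ _ => add_comm _ _⟩

@[simp]
theorem edgeWeight_mk (v w : V) :
    edgeWeight s(v, w) = Finsupp.single v 1 + Finsupp.single w 1 := rfl

/-- The multidegree, in the vertices of `G`, of an exponent vector in the edges of `G`. -/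
def vertexDegree (G : SimpleGraph V) : (G.edgeSet →₀ ℕ) →+ (V →₀ ℕ) :=
  Finsupp.liftAddHom fun e => (smulAddHom ℕ (V →₀ ℕ)).flip (edgeWeight e.1)

theorem vertexDegree_apply (G : SimpleGraph V) (u : G.edgeSet →₀ ℕ) :
    vertexDegree G u = u.sum fun e n => n • edgeWeight e.1 := rfl

theorem edgeMap_monomial (G : SimpleGraph V) (u : G.edgeSet →₀ ℕ) (c : K) :
    edgeMap K G (monomial u c) = monomial (vertexDegree G u) c := by
  have key (e : Sym2 V) :
      (e.map (X : V → MvPolynomial V K)).mul = monomial (edgeWeight e) 1 := by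
    induction e with
    | _ v w => simp [X, monomial_mul]
  rw [edgeMap, aeval_monomial, vertexDegree_apply, monomial_finsupp_sum_index]
  simp [key, monomial_pow, algebraMap_eq]

theorem binomial_mem_toricIdeal_iff {G : SimpleGraph V} {u v : G.edgeSet →₀ ℕ} :
    (monomial u 1 - monomial v 1 : MvPolynomial G.edgeSet K) ∈ toricIdeal K G ↔
      vertexDegree G u = vertexDegree G v := by
  rw [toricIdeal, RingHom.mem_ker, map_sub, edgeMap_monomial, edgeMap_monomial, sub_eq_zero,
    monomial_left_inj one_ne_zero]

/-- Every term of an element of the toric ideal has a companion of the same multidegree. -/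
theorem exists_ne_of_mem_toricIdeal {G : SimpleGraph V} {f : MvPolynomial G.edgeSet K}
    (hf : f ∈ toricIdeal K G) {d : G.edgeSet →₀ ℕ} (hd : d ∈ f.support) :
    ∃ u ∈ f.support, u ≠ d ∧ vertexDegree G u = vertexDegree G d := by
  classical
  by_contra! h
  have h0 : edgeMap K G f = 0 := hf
  rw [f.as_sum, map_sum] at h0
  -- Without a companion, only the term at `d` reaches this coefficient of the image, so nothing
  -- cancels it.
  have h1 := congrArg (coeff (vertexDegree G d)) h0
  simp only [edgeMap_monomial, coeff_sum, coeff_monomial, coeff_zero] at h1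
  rw [Finset.sum_eq_single_of_mem d hd fun u hu hne => if_neg (h u hu hne), if_pos rfl] at h1
  exact mem_support_iff.mp hd h1

/-- Induction on the size of the support: subtracting a multiple of a binomial trades the term at
`d` for one at a companion `u` already in the support, so the support shrinks. -/
theorem toricIdeal_le_of_binomial_mem {G : SimpleGraph V} {J : Ideal (MvPolynomial G.edgeSet K)}
    (hJ : ∀ u v : G.edgeSet →₀ ℕ, vertexDegree G u = vertexDegree G v →
      (monomial u 1 - monomial v 1 : MvPolynomial G.edgeSet K) ∈ J) :
    toricIdeal K G ≤ J := by
  classical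
  intro f
  induction hn : f.support.card using Nat.strong_induction_on generalizing f with
  | _ n ih =>
    intro hf
    by_cases h0 : f = 0
    · rw [h0]; exact J.zero_mem
    obtain ⟨d, hd⟩ := Finset.nonempty_of_ne_empty (mt support_eq_empty.mp h0)
    obtain ⟨u, hu, hne, hud⟩ := exists_ne_of_mem_toricIdeal hf hd
    have hg : C (coeff d f) * (monomial d 1 - monomial u 1) ∈ J :=
      J.mul_mem_left _ (hJ d u hud.symm)
    have hg' : C (coeff d f) * (monomial d 1 - monomial u 1) ∈ toricIdeal K G :=
      Ideal.mul_mem_left _ _ (binomial_mem_toricIdeal_iff.mpr hud.symm)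
    rw [← sub_add_cancel f (C (coeff d f) * (monomial d 1 - monomial u 1))]
    refine J.add_mem (ih _ ?_ rfl (Ideal.sub_mem _ hf hg')) hg
    rw [← hn]
    refine Finset.card_lt_card ⟨fun e he => ?_, fun hsub => ?_⟩
    · rw [mem_support_iff] at he ⊢
      intro hfe
      refine he ?_
      have hde : d ≠ e := by rintro rfl; exact mem_support_iff.mp hd hfe
      have hue : u ≠ e := by rintro rfl; exact mem_support_iff.mp hu hfe
      simp [coeff_C_mul, coeff_monomial, hfe, hde, hue]
    · have := mem_support_iff.mp (hsub hd)
      simp [coeff_C_mul, coeff_monomial, hne] at this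

/-! ### Consequences of conformality. -/

/-- Up to sign, `B` contains a nonzero binomial below every nonzero binomial of the toric ideal. -/
def IsConformal (G : SimpleGraph V) (B : Set (MvPolynomial G.edgeSet K)) : Prop :=
  ∀ u v : G.edgeSet →₀ ℕ, u ≠ v → vertexDegree G u = vertexDegree G v →
    ∃ p q : G.edgeSet →₀ ℕ, p ≤ u ∧ q ≤ v ∧ p ≠ q ∧
      ((monomial p 1 - monomial q 1 : MvPolynomial G.edgeSet K) ∈ B ∨
        -(monomial p 1 - monomial q 1 : MvPolynomial G.edgeSet K) ∈ B)

variable {G : SimpleGraph V} {B : Set (MvPolynomial G.edgeSet K)}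

theorem degree_tsub_add_degree_tsub_lt {σ : Type*} {u v p q : σ →₀ ℕ} (hp : p ≤ u) (hq : q ≤ v)
    (hpq : p ≠ q) : (u - p).degree + (v - q).degree < u.degree + v.degree := by
  have h1 : (u - p).degree + p.degree = u.degree := by
    rw [← map_add, tsub_add_cancel_of_le hp]
  have h2 : (v - q).degree + q.degree = v.degree := by
    rw [← map_add, tsub_add_cancel_of_le hq]
  have h3 : p.degree + q.degree ≠ 0 := by
    intro h
    rw [Nat.add_eq_zero_iff, Finsupp.degree_eq_zero_iff, Finsupp.degree_eq_zero_iff] at h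
    exact hpq (h.1.trans h.2.symm)
  omega

theorem vertexDegree_tsub_eq {u v p q : G.edgeSet →₀ ℕ} (hp : p ≤ u) (hq : q ≤ v)
    (huv : vertexDegree G u = vertexDegree G v) (hpq : vertexDegree G p = vertexDegree G q) :
    vertexDegree G (u - p) = vertexDegree G (v - q) := by
  rw [← tsub_add_cancel_of_le hp, ← tsub_add_cancel_of_le hq, map_add, map_add, hpq] at huv
  exact add_right_cancel huv

theorem vertexDegree_eq_of_mem (hBI : B ⊆ (toricIdeal K G : Set (MvPolynomial G.edgeSet K)))
    {p q : G.edgeSet →₀ ℕ}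
    (h : (monomial p 1 - monomial q 1 : MvPolynomial G.edgeSet K) ∈ B ∨
      -(monomial p 1 - monomial q 1 : MvPolynomial G.edgeSet K) ∈ B) :
    vertexDegree G p = vertexDegree G q :=
  binomial_mem_toricIdeal_iff.mp <| h.elim (fun h => hBI h) fun h => neg_mem_iff.mp (hBI h)

theorem IsConformal.binomial_mem_span (hB : IsConformal G B)
    (hBI : B ⊆ (toricIdeal K G : Set (MvPolynomial G.edgeSet K))) (u v : G.edgeSet →₀ ℕ)
    (huv : vertexDegree G u = vertexDegree G v) :
    (monomial u 1 - monomial v 1 : MvPolynomial G.edgeSet K) ∈ Ideal.span B := by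
  induction hn : u.degree + v.degree using Nat.strong_induction_on generalizing u v with
  | _ n ih =>
    by_cases hne : u = v
    · rw [hne, sub_self]; exact Ideal.zero_mem _
    obtain ⟨p, q, hp, hq, hpq, hmem⟩ := hB u v hne huv
    have hspan : (monomial p 1 - monomial q 1 : MvPolynomial G.edgeSet K) ∈ Ideal.span B :=
      hmem.elim (fun h => Ideal.subset_span h) fun h => neg_mem_iff.mp (Ideal.subset_span h)
    have hrec := ih _ (hn ▸ degree_tsub_add_degree_tsub_lt hp hq hpq) (u - p) (v - q)
      (vertexDegree_tsub_eq hp hq huv (vertexDegree_eq_of_mem hBI hmem)) rfl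
    have hu : (monomial u 1 : MvPolynomial G.edgeSet K) =
        monomial (u - p) 1 * monomial p 1 := by
      rw [monomial_mul, tsub_add_cancel_of_le hp, one_mul]
    have hv : (monomial v 1 : MvPolynomial G.edgeSet K) =
        monomial (v - q) 1 * monomial q 1 := by
      rw [monomial_mul, tsub_add_cancel_of_le hq, one_mul]
    have : (monomial u 1 - monomial v 1 : MvPolynomial G.edgeSet K) =
        monomial (u - p) 1 * (monomial p 1 - monomial q 1) +
          monomial q 1 * (monomial (u - p) 1 - monomial (v - q) 1) := by
      rw [hu, hv]; ring
    rw [this]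
    exact Ideal.add_mem _ (Ideal.mul_mem_left _ _ hspan) (Ideal.mul_mem_left _ _ hrec)

theorem IsConformal.toricIdeal_eq_span (hB : IsConformal G B)
    (hBI : B ⊆ (toricIdeal K G : Set (MvPolynomial G.edgeSet K))) :
    toricIdeal K G = Ideal.span B :=
  le_antisymm (toricIdeal_le_of_binomial_mem (hB.binomial_mem_span hBI)) (Ideal.span_le.mpr hBI)

theorem IsConformal.mem_of_isPrimitiveBinomial (hB : IsConformal G B)
    (hBI : B ⊆ (toricIdeal K G : Set (MvPolynomial G.edgeSet K))) {f : MvPolynomial G.edgeSet K}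
    (hf : IsPrimitiveBinomial (toricIdeal K G) f) : f ∈ B ∨ -f ∈ B := by
  obtain ⟨u, v, hne, rfl, hmem, hmin⟩ := hf
  obtain ⟨p, q, hp, hq, hpq, h⟩ := hB u v hne (binomial_mem_toricIdeal_iff.mp hmem)
  obtain ⟨rfl, rfl⟩ := hmin p q hpq
    (binomial_mem_toricIdeal_iff.mpr (vertexDegree_eq_of_mem hBI h))
    (monomial_dvd_monomial.mpr ⟨Or.inr hp, dvd_rfl⟩)
    (monomial_dvd_monomial.mpr ⟨Or.inr hq, dvd_rfl⟩)
  exact h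

open scoped MonomialOrder

/-- A conformal set has a binomial below `u - v` that is oriented in the same way as `u - v`. -/
theorem IsConformal.exists_lt (hB : IsConformal G B)
    (hBI : B ⊆ (toricIdeal K G : Set (MvPolynomial G.edgeSet K)))
    (m : MonomialOrder.{_, w} G.edgeSet) (u v : G.edgeSet →₀ ℕ)
    (huv : vertexDegree G u = vertexDegree G v) (hlt : m.toSyn v < m.toSyn u) :
    ∃ p q : G.edgeSet →₀ ℕ, p ≤ u ∧ m.toSyn q < m.toSyn p ∧
      ((monomial p 1 - monomial q 1 : MvPolynomial G.edgeSet K) ∈ B ∨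
        -(monomial p 1 - monomial q 1 : MvPolynomial G.edgeSet K) ∈ B) := by
  induction hn : u.degree + v.degree using Nat.strong_induction_on generalizing u v with
  | _ n ih =>
    obtain ⟨p, q, hp, hq, hpq, hmem⟩ := hB u v (by rintro rfl; exact lt_irrefl _ hlt) huv
    by_cases hqp : m.toSyn q < m.toSyn p
    · exact ⟨p, q, hp, hqp, hmem⟩
    -- If the remainders were not oriented like `u` and `v` either, adding them to `p ≤ q` would
    -- contradict `v < u`.
    have hlt' : m.toSyn (v - q) < m.toSyn (u - p) := by
      by_contra! hle
      refine hlt.not_ge ?_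
      rw [← tsub_add_cancel_of_le hp, ← tsub_add_cancel_of_le hq, map_add, map_add]
      exact add_le_add hle (not_lt.mp hqp)
    obtain ⟨p', q', hp', h⟩ := ih _ (hn ▸ degree_tsub_add_degree_tsub_lt hp hq hpq) (u - p)
      (v - q) (vertexDegree_tsub_eq hp hq huv (vertexDegree_eq_of_mem hBI hmem)) hlt' rfl
    exact ⟨p', q', hp'.trans tsub_le_self, h⟩

theorem leadingTerm_binomial {σ : Type*} (m : MonomialOrder.{_, w} σ) {p q : σ →₀ ℕ}
    (h : m.toSyn q < m.toSyn p) :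
    m.leadingTerm (monomial p 1 - monomial q 1 : MvPolynomial σ K) = monomial p 1 := by
  classical
  have hlt : m.toSyn (m.degree (monomial q 1 : MvPolynomial σ K)) <
      m.toSyn (m.degree (monomial p 1 : MvPolynomial σ K)) := by
    simpa [m.degree_monomial] using h
  rw [MonomialOrder.leadingTerm, m.degree_sub_of_lt hlt, m.leadingCoeff_sub_of_lt hlt,
    m.leadingCoeff_monomial, m.degree_monomial, if_neg one_ne_zero]

theorem leadingTerm_neg {σ : Type*} (m : MonomialOrder.{_, w} σ) (f : MvPolynomial σ K) :
    m.leadingTerm (-f) = -m.leadingTerm f := by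
  rw [MonomialOrder.leadingTerm, MonomialOrder.leadingTerm, m.degree_neg, m.leadingCoeff_neg,
    map_neg]

theorem IsConformal.isUniversalGroebnerBasis (hB : IsConformal G B) (hfin : B.Finite)
    (hBI : B ⊆ (toricIdeal K G : Set (MvPolynomial G.edgeSet K))) :
    IsUniversalGroebnerBasis.{w} B (toricIdeal K G) := by
  intro m
  refine ⟨hfin, hBI, le_antisymm ?_ (Ideal.span_mono (Set.image_mono hBI))⟩
  rw [initialIdeal, Ideal.span_le]
  rintro _ ⟨f, hf, rfl⟩
  by_cases h0 : f = 0
  · rw [h0, m.leadingTerm_zero]; exact Ideal.zero_mem _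
  -- The companion of the leading exponent lies in the support, hence is strictly smaller in the
  -- order.
  obtain ⟨u, hu, hne, hdeg⟩ := exists_ne_of_mem_toricIdeal hf (m.degree_mem_support h0)
  obtain ⟨p, q, hp, hqp, hmem⟩ := hB.exists_lt hBI m (m.degree f) u hdeg.symm
    (lt_of_le_of_ne (m.le_degree hu) (m.toSyn.injective.ne hne))
  have hspan : (monomial p 1 : MvPolynomial G.edgeSet K) ∈ Ideal.span (m.leadingTerm '' B) := by
    rcases hmem with h | h
    · exact Ideal.subset_span ⟨_, h, leadingTerm_binomial m hqp⟩
    · rw [← neg_mem_iff]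
      exact Ideal.subset_span ⟨_, h, by rw [leadingTerm_neg, leadingTerm_binomial m hqp]⟩
  refine Ideal.mem_of_dvd _ ?_ hspan
  exact monomial_dvd_monomial.mpr ⟨Or.inr hp, one_dvd _⟩

theorem IsPrimitiveBinomial.neg {σ : Type*} {I : Ideal (MvPolynomial σ K)}
    {f : MvPolynomial σ K} (hf : IsPrimitiveBinomial I f) : IsPrimitiveBinomial I (-f) := by
  obtain ⟨u, v, hne, rfl, hmem, hmin⟩ := hf
  refine ⟨v, u, hne.symm, neg_sub _ _, I.neg_mem hmem, fun v' u' hne' hI hv hu => ?_⟩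
  refine (hmin u' v' hne'.symm ?_ hu hv).symm
  rw [← neg_sub]
  exact I.neg_mem hI

end General

end ToricGraph

namespace ToricGraph

open Vert

section GraphG

variable {t : ℕ}

/-! ### Coordinates on the edges of `G_t` and its degree equations. -/

/-- The edges of `G_t`, in the order `a`, `b`, `e`, `f`. -/
abbrev EdgeLabel (t : ℕ) : Type := (Fin t ⊕ Fin t) ⊕ (Fin 3 ⊕ Fin 3)

abbrev lA (i : Fin t) : EdgeLabel t := Sum.inl (Sum.inl i)
abbrev lB (i : Fin t) : EdgeLabel t := Sum.inl (Sum.inr i)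
abbrev lE (i : Fin 3) : EdgeLabel t := Sum.inr (Sum.inl i)
abbrev lF (i : Fin 3) : EdgeLabel t := Sum.inr (Sum.inr i)

/-- The pair of vertices named by a label. -/
def labelSym2 : EdgeLabel t → Sym2 (Vert t)
  | Sum.inl (Sum.inl i) => s(x₁, y i)
  | Sum.inl (Sum.inr i) => s(x₂, y i)
  | Sum.inr (Sum.inl 0) => s(x₁, z₁)
  | Sum.inr (Sum.inl 1) => s(z₁, z₂)
  | Sum.inr (Sum.inl 2) => s(z₂, x₁)
  | Sum.inr (Sum.inr 0) => s(x₂, w₁)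
  | Sum.inr (Sum.inr 1) => s(w₁, w₂)
  | Sum.inr (Sum.inr 2) => s(w₂, x₂)

theorem labelSym2_mem (l : EdgeLabel t) : labelSym2 l ∈ (graphG t).edgeSet := by
  rw [edgeSet_graphG]
  rcases l with (i | i) | (i | i)
  · simp [labelSym2, edges]
  · simp [labelSym2, edges]
  · fin_cases i <;> simp [labelSym2, edges]
  · fin_cases i <;> simp [labelSym2, edges]

theorem labelSym2_injective : Function.Injective (labelSym2 (t := t)) := by
  rintro ((i | i) | (i | i)) ((j | j) | (j | j)) h <;> (try fin_cases i) <;>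
    (try fin_cases j) <;> simp_all [labelSym2]

theorem exists_labelSym2_eq {e : Sym2 (Vert t)} (he : e ∈ edges t) :
    ∃ l : EdgeLabel t, labelSym2 l = e := by
  simp only [edges, Set.mem_union, Set.mem_range, Set.mem_insert_iff,
    Set.mem_singleton_iff] at he
  rcases he with ((⟨i, rfl⟩ | ⟨i, rfl⟩) | rfl | rfl | rfl) | rfl | rfl | rfl
  exacts [⟨lA i, rfl⟩, ⟨lB i, rfl⟩, ⟨lE 0, rfl⟩, ⟨lE 1, rfl⟩, ⟨lE 2, rfl⟩, ⟨lF 0, rfl⟩,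
    ⟨lF 1, rfl⟩, ⟨lF 2, rfl⟩]

/-- The labels enumerate the edges of `G_t`. -/
def labelEquiv (t : ℕ) : EdgeLabel t ≃ (graphG t).edgeSet :=
  Equiv.ofBijective (fun l => ⟨labelSym2 l, labelSym2_mem l⟩)
    ⟨fun _ _ h => labelSym2_injective (congrArg Subtype.val h), fun e =>
      let ⟨l, hl⟩ := exists_labelSym2_eq ((edgeSet_graphG t) ▸ e.2)
      ⟨l, Subtype.ext hl⟩⟩

/-- The exponent vector of the variable with the given label. -/
def unit (l : EdgeLabel t) : (graphG t).edgeSet →₀ ℕ := Finsupp.single (labelEquiv t l) 1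

theorem unit_apply (l k : EdgeLabel t) : unit l (labelEquiv t k) = if l = k then 1 else 0 := by
  classical
  simp [unit, Finsupp.single_apply]

theorem forall_labelEquiv {P : (graphG t).edgeSet → Prop}
    (ha : ∀ i, P (labelEquiv t (lA i))) (hb : ∀ i, P (labelEquiv t (lB i)))
    (he : ∀ i, P (labelEquiv t (lE i))) (hf : ∀ i, P (labelEquiv t (lF i))) (e) : P e := by
  obtain ⟨l, rfl⟩ := (labelEquiv t).surjective e
  rcases l with (i | i) | (i | i)
  exacts [ha i, hb i, he i, hf i]

theorem vertexDegree_eq_sum (u : (graphG t).edgeSet →₀ ℕ) :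
    vertexDegree (graphG t) u = ∑ l, u (labelEquiv t l) • edgeWeight (labelSym2 l) := by
  have : Fintype (graphG t).edgeSet := Fintype.ofEquiv _ (labelEquiv t)
  rw [vertexDegree_apply, Finsupp.sum_fintype _ _ (by simp), ← (labelEquiv t).sum_comp]
  rfl

theorem vertexDegree_apply_x₁ (u : (graphG t).edgeSet →₀ ℕ) :
    vertexDegree (graphG t) u x₁ = ∑ i, u (labelEquiv t (lA i)) + u (labelEquiv t (lE 0)) +
      u (labelEquiv t (lE 2)) := by
  simp [vertexDegree_eq_sum, Fin.sum_univ_three, labelSym2, add_assoc]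

theorem vertexDegree_apply_x₂ (u : (graphG t).edgeSet →₀ ℕ) :
    vertexDegree (graphG t) u x₂ = ∑ i, u (labelEquiv t (lB i)) + u (labelEquiv t (lF 0)) +
      u (labelEquiv t (lF 2)) := by
  simp [vertexDegree_eq_sum, Fin.sum_univ_three, labelSym2, add_assoc]

theorem vertexDegree_apply_y (u : (graphG t).edgeSet →₀ ℕ) (i : Fin t) :
    vertexDegree (graphG t) u (y i) = u (labelEquiv t (lA i)) + u (labelEquiv t (lB i)) := by
  classical
  simp [vertexDegree_eq_sum, Fin.sum_univ_three, labelSym2, Finsupp.single_apply]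

theorem vertexDegree_apply_z₁ (u : (graphG t).edgeSet →₀ ℕ) :
    vertexDegree (graphG t) u z₁ = u (labelEquiv t (lE 0)) + u (labelEquiv t (lE 1)) := by
  simp [vertexDegree_eq_sum, Fin.sum_univ_three, labelSym2]

theorem vertexDegree_apply_z₂ (u : (graphG t).edgeSet →₀ ℕ) :
    vertexDegree (graphG t) u z₂ = u (labelEquiv t (lE 1)) + u (labelEquiv t (lE 2)) := by
  simp [vertexDegree_eq_sum, Fin.sum_univ_three, labelSym2]

theorem vertexDegree_apply_w₁ (u : (graphG t).edgeSet →₀ ℕ) :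
    vertexDegree (graphG t) u w₁ = u (labelEquiv t (lF 0)) + u (labelEquiv t (lF 1)) := by
  simp [vertexDegree_eq_sum, Fin.sum_univ_three, labelSym2]

theorem vertexDegree_apply_w₂ (u : (graphG t).edgeSet →₀ ℕ) :
    vertexDegree (graphG t) u w₂ = u (labelEquiv t (lF 1)) + u (labelEquiv t (lF 2)) := by
  simp [vertexDegree_eq_sum, Fin.sum_univ_three, labelSym2]

/-- One linear equation per vertex, in a form that `omega` can use. -/
theorem vertexDegree_eq_iff {u v : (graphG t).edgeSet →₀ ℕ} :
    vertexDegree (graphG t) u = vertexDegree (graphG t) v ↔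
      (∑ i, u (labelEquiv t (lA i)) + u (labelEquiv t (lE 0)) + u (labelEquiv t (lE 2)) =
        ∑ i, v (labelEquiv t (lA i)) + v (labelEquiv t (lE 0)) + v (labelEquiv t (lE 2))) ∧
      (∑ i, u (labelEquiv t (lB i)) + u (labelEquiv t (lF 0)) + u (labelEquiv t (lF 2)) =
        ∑ i, v (labelEquiv t (lB i)) + v (labelEquiv t (lF 0)) + v (labelEquiv t (lF 2))) ∧
      (∀ i, u (labelEquiv t (lA i)) + u (labelEquiv t (lB i)) =
        v (labelEquiv t (lA i)) + v (labelEquiv t (lB i))) ∧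
      (u (labelEquiv t (lE 0)) + u (labelEquiv t (lE 1)) =
        v (labelEquiv t (lE 0)) + v (labelEquiv t (lE 1))) ∧
      (u (labelEquiv t (lE 1)) + u (labelEquiv t (lE 2)) =
        v (labelEquiv t (lE 1)) + v (labelEquiv t (lE 2))) ∧
      (u (labelEquiv t (lF 0)) + u (labelEquiv t (lF 1)) =
        v (labelEquiv t (lF 0)) + v (labelEquiv t (lF 1))) ∧
      (u (labelEquiv t (lF 1)) + u (labelEquiv t (lF 2)) =
        v (labelEquiv t (lF 1)) + v (labelEquiv t (lF 2))) := by
  simp only [← vertexDegree_apply_x₁, ← vertexDegree_apply_x₂, ← vertexDegree_apply_y,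
    ← vertexDegree_apply_z₁, ← vertexDegree_apply_z₂, ← vertexDegree_apply_w₁,
    ← vertexDegree_apply_w₂]
  refine ⟨fun h => by simp [h], fun h => Finsupp.ext fun x => ?_⟩
  obtain ⟨h₁, h₂, h₃, h₄, h₅, h₆, h₇⟩ := h
  cases x
  exacts [h₁, h₂, h₃ _, h₄, h₅, h₆, h₇]

/-! ### The exponents of the family. -/

/-- The exponent of `a_i b_j`. -/
def squareExp (i j : Fin t) : (graphG t).edgeSet →₀ ℕ := unit (lA i) + unit (lB j)

/-- The exponent of `a_i a_j f₁ f₃ e₂`. -/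
def leftExp (i j : Fin t) : (graphG t).edgeSet →₀ ℕ :=
  unit (lA i) + unit (lA j) + unit (lF 0) + unit (lF 2) + unit (lE 1)

/-- The exponent of `f₂ e₁ e₃ b_i b_j`. -/
def rightExp (i j : Fin t) : (graphG t).edgeSet →₀ ℕ :=
  unit (lF 1) + unit (lE 0) + unit (lE 2) + unit (lB i) + unit (lB j)

variable (K : Type*) [Field K]

theorem monomial_add_one {σ : Type*} (u v : σ →₀ ℕ) :
    (monomial (u + v) 1 : MvPolynomial σ K) = monomial u 1 * monomial v 1 := by
  rw [monomial_mul, one_mul]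

theorem monomial_squareExp (i j : Fin t) :
    (monomial (squareExp i j) 1 : MvPolynomial (graphG t).edgeSet K) = a K i * b K j := by
  rw [squareExp, monomial_add_one]; rfl

theorem monomial_leftExp (i j : Fin t) :
    (monomial (leftExp i j) 1 : MvPolynomial (graphG t).edgeSet K) =
      a K i * a K j * f₁ K * f₃ K * e₂ K := by
  simp only [leftExp, monomial_add_one]; rfl

theorem monomial_rightExp (i j : Fin t) :
    (monomial (rightExp i j) 1 : MvPolynomial (graphG t).edgeSet K) =
      f₂ K * e₁ K * e₃ K * b K i * b K j := by
  simp only [rightExp, monomial_add_one]; rfl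

theorem vertexDegree_squareExp (i j : Fin t) :
    vertexDegree (graphG t) (squareExp i j) = vertexDegree (graphG t) (squareExp j i) := by
  rw [vertexDegree_eq_iff]
  simp [squareExp, unit_apply, add_comm]

theorem vertexDegree_leftExp (i j : Fin t) :
    vertexDegree (graphG t) (leftExp i j) = vertexDegree (graphG t) (rightExp i j) := by
  rw [vertexDegree_eq_iff]
  simp [leftExp, rightExp, unit_apply, Finset.sum_add_distrib]

variable {K}

/-- The second and third families merge into one, with `i = j` allowed. -/
theorem mem_family_iff {p : MvPolynomial (graphG t).edgeSet K} :
    p ∈ family K t ↔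
      (∃ i j : Fin t, i < j ∧ p = monomial (squareExp i j) 1 - monomial (squareExp j i) 1) ∨
        ∃ i j : Fin t, i ≤ j ∧ p = monomial (leftExp i j) 1 - monomial (rightExp i j) 1 := by
  simp only [family, family₁, family₂, family₃, Set.mem_union, Set.mem_ofPred_eq,
    monomial_squareExp, monomial_leftExp, monomial_rightExp, or_assoc]
  refine or_congr Iff.rfl ⟨?_, ?_⟩
  · rintro (⟨i, j, h, rfl⟩ | ⟨i, rfl⟩)
    · exact ⟨i, j, h.le, rfl⟩
    · exact ⟨i, i, le_rfl, by ring⟩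
  · rintro ⟨i, j, h, rfl⟩
    rcases h.lt_or_eq with h | rfl
    · exact Or.inl ⟨i, j, h, rfl⟩
    · exact Or.inr ⟨i, by ring⟩

theorem square_mem_family {i j : Fin t} (h : i ≠ j) :
    (monomial (squareExp i j) 1 - monomial (squareExp j i) 1 :
        MvPolynomial (graphG t).edgeSet K) ∈ family K t ∨
      -(monomial (squareExp i j) 1 - monomial (squareExp j i) 1 :
        MvPolynomial (graphG t).edgeSet K) ∈ family K t := by
  rcases h.lt_or_gt with h | h
  · exact Or.inl (mem_family_iff.mpr (Or.inl ⟨i, j, h, rfl⟩))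
  · exact Or.inr (mem_family_iff.mpr (Or.inl ⟨j, i, h, neg_sub _ _⟩))

theorem left_sub_right_mem_family (i j : Fin t) :
    (monomial (leftExp i j) 1 - monomial (rightExp i j) 1 :
        MvPolynomial (graphG t).edgeSet K) ∈ family K t := by
  rw [mem_family_iff]
  rcases le_total i j with h | h
  · exact Or.inr ⟨i, j, h, rfl⟩
  · refine Or.inr ⟨j, i, h, ?_⟩
    simp only [monomial_leftExp, monomial_rightExp]
    ring

theorem family_subset_toricIdeal :
    family K t ⊆ (toricIdeal K (graphG t) : Set (MvPolynomial (graphG t).edgeSet K)) := by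
  intro p hp
  rcases mem_family_iff.mp hp with ⟨i, j, -, rfl⟩ | ⟨i, j, -, rfl⟩
  · exact binomial_mem_toricIdeal_iff.mpr (vertexDegree_squareExp i j)
  · exact binomial_mem_toricIdeal_iff.mpr (vertexDegree_leftExp i j)

theorem family_finite : (family K t).Finite := by
  refine ((Set.finite_range fun x : Fin t × Fin t =>
    (monomial (squareExp x.1 x.2) 1 - monomial (squareExp x.2 x.1) 1 :
      MvPolynomial (graphG t).edgeSet K)).union (Set.finite_range fun x : Fin t × Fin t =>
    (monomial (leftExp x.1 x.2) 1 - monomial (rightExp x.1 x.2) 1 :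
      MvPolynomial (graphG t).edgeSet K))).subset fun p hp => ?_
  rcases mem_family_iff.mp hp with ⟨i, j, -, rfl⟩ | ⟨i, j, -, rfl⟩
  · exact Or.inl ⟨(i, j), rfl⟩
  · exact Or.inr ⟨(i, j), rfl⟩

theorem squareExp_le {u : (graphG t).edgeSet →₀ ℕ} {i j : Fin t}
    (hi : 1 ≤ u (labelEquiv t (lA i))) (hj : 1 ≤ u (labelEquiv t (lB j))) :
    squareExp i j ≤ u := by
  refine forall_labelEquiv (fun k => ?_) (fun k => ?_) (fun k => ?_) (fun k => ?_)
  · by_cases h : i = k <;> simp_all [squareExp, unit_apply]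
  · by_cases h : j = k <;> simp_all [squareExp, unit_apply]
  · simp [squareExp, unit_apply]
  · simp [squareExp, unit_apply]

theorem leftExp_le {u : (graphG t).edgeSet →₀ ℕ} {i j : Fin t}
    (hij : ∀ k, (if i = k then 1 else 0) + (if j = k then 1 else 0) ≤ u (labelEquiv t (lA k)))
    (h₀ : 1 ≤ u (labelEquiv t (lF 0))) (h₂ : 1 ≤ u (labelEquiv t (lF 2)))
    (h₁ : 1 ≤ u (labelEquiv t (lE 1))) : leftExp i j ≤ u := by
  refine forall_labelEquiv (fun k => ?_) (fun k => ?_) (fun k => ?_) (fun k => ?_)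
  · simpa [leftExp, unit_apply] using hij k
  · simp [leftExp, unit_apply]
  · fin_cases k <;> simp_all [leftExp, unit_apply]
  · fin_cases k <;> simp_all [leftExp, unit_apply]

theorem rightExp_le {u : (graphG t).edgeSet →₀ ℕ} {i j : Fin t}
    (hij : ∀ k, (if i = k then 1 else 0) + (if j = k then 1 else 0) ≤ u (labelEquiv t (lB k)))
    (h₀ : 1 ≤ u (labelEquiv t (lE 0))) (h₂ : 1 ≤ u (labelEquiv t (lE 2)))
    (h₁ : 1 ≤ u (labelEquiv t (lF 1))) : rightExp i j ≤ u := by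
  refine forall_labelEquiv (fun k => ?_) (fun k => ?_) (fun k => ?_) (fun k => ?_)
  · simp [rightExp, unit_apply]
  · simpa [rightExp, unit_apply] using hij k
  · fin_cases k <;> simp_all [rightExp, unit_apply]
  · fin_cases k <;> simp_all [rightExp, unit_apply]

theorem squareExp_ne {i j : Fin t} (h : i ≠ j) : squareExp i j ≠ squareExp j i := fun heq => by
  have := DFunLike.congr_fun heq (labelEquiv t (lA i))
  simp [squareExp, unit_apply, h.symm] at this

theorem leftExp_ne_rightExp (i j : Fin t) : leftExp i j ≠ rightExp i j := fun heq => by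
  have := DFunLike.congr_fun heq (labelEquiv t (lE 1))
  simp [leftExp, rightExp, unit_apply] at this

/-- Two functions `g ≤ f` whose sums differ by at least two differ at two places, or by two at one
place. -/
theorem exists_pair_of_sum_add_two_le {ι : Type*} [Fintype ι] [DecidableEq ι] {f g : ι → ℕ}
    (hle : ∀ i, g i ≤ f i) (hsum : ∑ i, g i + 2 ≤ ∑ i, f i) :
    ∃ i j, ∀ k, (if i = k then 1 else 0) + (if j = k then 1 else 0) + g k ≤ f k := by
  obtain ⟨i, -, hi⟩ := Finset.exists_lt_of_sum_lt (show ∑ i, g i < ∑ i, f i by omega)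
  -- A gap of two survives one increment of `g` at `i`, so a second index exists, possibly `i`
  -- again.
  have hsum' : ∑ k, ((if i = k then 1 else 0) + g k) < ∑ k, f k := by
    simp only [Finset.sum_add_distrib, Finset.sum_ite_eq, Finset.mem_univ, if_true]
    omega
  obtain ⟨j, -, hj⟩ := Finset.exists_lt_of_sum_lt hsum'
  refine ⟨i, j, fun k => ?_⟩
  have := hle k
  by_cases h1 : i = k <;> by_cases h2 : j = k
  · subst h1 h2; simp at hj ⊢; omega
  · subst h1; simp [h2]; omega
  · subst h2; simp [h1] at hj ⊢; omega
  · simpa [h1, h2]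

/-! ### Conformality of the family. -/

/-- The triangle at `x₁` makes the total `a`-excess of `u` twice its `e₂`-excess. The hypotheses
give these opposite signs, so both vanish and the remaining exponents follow. -/
theorem eq_of_forall_a_le {u v : (graphG t).edgeSet →₀ ℕ}
    (huv : vertexDegree (graphG t) u = vertexDegree (graphG t) v)
    (hle : ∀ i, v (labelEquiv t (lA i)) ≤ u (labelEquiv t (lA i)))
    (he : u (labelEquiv t (lE 1)) ≤ v (labelEquiv t (lE 1))) : u = v := by
  obtain ⟨h₁, h₂, h₃, h₄, h₅, h₆, h₇⟩ := vertexDegree_eq_iff.mp huv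
  have hs := Finset.sum_le_sum fun i (_ : i ∈ Finset.univ) => hle i
  have ha : ∀ i, v (labelEquiv t (lA i)) = u (labelEquiv t (lA i)) := by
    have := (Finset.sum_eq_sum_iff_of_le fun i (_ : i ∈ Finset.univ) => hle i).mp (by omega)
    exact fun i => this i (Finset.mem_univ i)
  have hb : ∀ i, u (labelEquiv t (lB i)) = v (labelEquiv t (lB i)) := fun i => by
    have := h₃ i
    have := ha i
    omega
  have hbs := Finset.sum_congr rfl fun i (_ : i ∈ Finset.univ) => hb i
  refine Finsupp.ext (forall_labelEquiv (fun i => (ha i).symm) hb (fun i => ?_) (fun i => ?_))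
  · fin_cases i <;> dsimp <;> omega
  · fin_cases i <;> dsimp <;> omega

theorem exists_leftExp_le {u v : (graphG t).edgeSet →₀ ℕ} (hne : u ≠ v)
    (huv : vertexDegree (graphG t) u = vertexDegree (graphG t) v)
    (hle : ∀ i, v (labelEquiv t (lA i)) ≤ u (labelEquiv t (lA i))) :
    ∃ i j, leftExp i j ≤ u ∧ rightExp i j ≤ v := by
  have he := not_le.mp (mt (eq_of_forall_a_le huv hle) hne)
  obtain ⟨h₁, h₂, h₃, h₄, h₅, h₆, h₇⟩ := vertexDegree_eq_iff.mp huv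
  have hs := Finset.sum_le_sum fun i (_ : i ∈ Finset.univ) => hle i
  have hab : ∑ i, u (labelEquiv t (lA i)) + ∑ i, u (labelEquiv t (lB i)) =
      ∑ i, v (labelEquiv t (lA i)) + ∑ i, v (labelEquiv t (lB i)) := by
    rw [← Finset.sum_add_distrib, ← Finset.sum_add_distrib]
    exact Finset.sum_congr rfl fun i _ => h₃ i
  -- By `he` the `e₂`-excess is at least one, so the total `a`-excess is at least two.
  obtain ⟨i, j, hij⟩ := exists_pair_of_sum_add_two_le hle (by omega)
  refine ⟨i, j, leftExp_le (fun k => ?_) (by omega) (by omega) (by omega),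
    rightExp_le (fun k => ?_) (by omega) (by omega) (by omega)⟩
  · have := hij k
    omega
  · have := hij k
    have := h₃ k
    omega

theorem isConformal_family : IsConformal (graphG t) (family K t) := by
  intro u v hne huv
  by_cases h : ∀ i, v (labelEquiv t (lA i)) ≤ u (labelEquiv t (lA i))
  · obtain ⟨i, j, hi, hj⟩ := exists_leftExp_le hne huv h
    exact ⟨_, _, hi, hj, leftExp_ne_rightExp i j, Or.inl (left_sub_right_mem_family i j)⟩
  by_cases h' : ∀ i, u (labelEquiv t (lA i)) ≤ v (labelEquiv t (lA i))
  · obtain ⟨i, j, hi, hj⟩ := exists_leftExp_le hne.symm huv.symm h'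
    refine ⟨_, _, hj, hi, (leftExp_ne_rightExp i j).symm, Or.inr ?_⟩
    rw [neg_sub]
    exact left_sub_right_mem_family i j
  push Not at h h'
  obtain ⟨j, hj⟩ := h
  obtain ⟨i, hi⟩ := h'
  have hy := (vertexDegree_eq_iff.mp huv).2.2.1
  have hyi := hy i
  have hyj := hy j
  have hij : i ≠ j := by rintro rfl; omega
  exact ⟨squareExp i j, squareExp j i, squareExp_le (by omega) (by omega),
    squareExp_le (by omega) (by omega), squareExp_ne hij, square_mem_family hij⟩

/-! ### Primitivity of the family. -/

theorem isPrimitiveBinomial_of_minimal {u v : (graphG t).edgeSet →₀ ℕ} (hne : u ≠ v)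
    (huv : vertexDegree (graphG t) u = vertexDegree (graphG t) v)
    (hmin : ∀ u' v', u' ≠ v' → vertexDegree (graphG t) u' = vertexDegree (graphG t) v' →
      u' ≤ u → v' ≤ v → u ≤ u' ∧ v ≤ v') :
    IsPrimitiveBinomial (toricIdeal K (graphG t)) (monomial u 1 - monomial v 1) := by
  refine ⟨u, v, hne, rfl, binomial_mem_toricIdeal_iff.mpr huv, fun u' v' hne' hmem hu hv => ?_⟩
  have hu' : u' ≤ u := by simpa using (monomial_dvd_monomial.mp hu).1
  have hv' : v' ≤ v := by simpa using (monomial_dvd_monomial.mp hv).1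
  have h := hmin u' v' hne' (binomial_mem_toricIdeal_iff.mp hmem) hu' hv'
  exact ⟨le_antisymm hu' h.1, le_antisymm hv' h.2⟩

theorem isPrimitiveBinomial_square {i j : Fin t} (hij : i ≠ j) :
    IsPrimitiveBinomial (toricIdeal K (graphG t))
      (monomial (squareExp i j) 1 - monomial (squareExp j i) 1) := by
  refine isPrimitiveBinomial_of_minimal (squareExp_ne hij) (vertexDegree_squareExp i j)
    fun u v hne huv hu hv => ?_
  have hua k : u (labelEquiv t (lA k)) ≤ if i = k then 1 else 0 := by
    simpa [squareExp, unit_apply] using hu (labelEquiv t (lA k))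
  have hva k : v (labelEquiv t (lA k)) ≤ if j = k then 1 else 0 := by
    simpa [squareExp, unit_apply] using hv (labelEquiv t (lA k))
  have hue k : u (labelEquiv t (lE k)) = 0 := by
    simpa [squareExp, unit_apply] using hu (labelEquiv t (lE k))
  have hve k : v (labelEquiv t (lE k)) = 0 := by
    simpa [squareExp, unit_apply] using hv (labelEquiv t (lE k))
  -- Otherwise `u` contains no `a` at all; as `e₂` occurs on neither side, `eq_of_forall_a_le` would
  -- force `u = v`.
  have hui : 1 ≤ u (labelEquiv t (lA i)) := by
    by_contra! h
    refine hne.symm (eq_of_forall_a_le huv.symm (fun k => ?_) (by rw [hue, hve]))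
    have := hua k
    split_ifs at this with hk
    · subst hk; omega
    · omega
  have hvj : 1 ≤ v (labelEquiv t (lA j)) := by
    by_contra! h
    refine hne (eq_of_forall_a_le huv (fun k => ?_) (by rw [hue, hve]))
    have := hva k
    split_ifs at this with hk
    · subst hk; omega
    · omega
  have hy := (vertexDegree_eq_iff.mp huv).2.2.1
  have hyi := hy i
  have hyj := hy j
  have huj := hua j
  have hvi := hva i
  rw [if_neg hij] at huj
  rw [if_neg hij.symm] at hvi
  exact ⟨squareExp_le hui (by omega), squareExp_le hvj (by omega)⟩

theorem isPrimitiveBinomial_left_sub_right (i j : Fin t) :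
    IsPrimitiveBinomial (toricIdeal K (graphG t))
      (monomial (leftExp i j) 1 - monomial (rightExp i j) 1) := by
  refine isPrimitiveBinomial_of_minimal (leftExp_ne_rightExp i j) (vertexDegree_leftExp i j)
    fun u v hne huv hu hv => ?_
  have hua k : u (labelEquiv t (lA k)) ≤ (if i = k then 1 else 0) + if j = k then 1 else 0 := by
    simpa [leftExp, unit_apply] using hu (labelEquiv t (lA k))
  have hub k : u (labelEquiv t (lB k)) = 0 := by
    simpa [leftExp, unit_apply] using hu (labelEquiv t (lB k))
  have hue₀ : u (labelEquiv t (lE 0)) = 0 := by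
    simpa [leftExp, unit_apply] using hu (labelEquiv t (lE 0))
  have hue₂ : u (labelEquiv t (lE 2)) = 0 := by
    simpa [leftExp, unit_apply] using hu (labelEquiv t (lE 2))
  have huf₁ : u (labelEquiv t (lF 1)) = 0 := by
    simpa [leftExp, unit_apply] using hu (labelEquiv t (lF 1))
  have hva k : v (labelEquiv t (lA k)) = 0 := by
    simpa [rightExp, unit_apply] using hv (labelEquiv t (lA k))
  have hvf₀ : v (labelEquiv t (lF 0)) = 0 := by
    simpa [rightExp, unit_apply] using hv (labelEquiv t (lF 0))
  have hvf₂ : v (labelEquiv t (lF 2)) = 0 := by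
    simpa [rightExp, unit_apply] using hv (labelEquiv t (lF 2))
  -- There is no `a` in `v`, so `u` dominates trivially and must have a positive `e₂`-excess.
  have he := not_le.mp (mt (eq_of_forall_a_le huv fun k => by rw [hva]; exact Nat.zero_le _) hne)
  obtain ⟨h₁, h₂, h₃, h₄, h₅, h₆, h₇⟩ := vertexDegree_eq_iff.mp huv
  have hb : ∑ k, v (labelEquiv t (lB k)) = ∑ k, u (labelEquiv t (lA k)) :=
    Finset.sum_congr rfl fun k _ => by simpa [hub, hva] using (h₃ k).symm
  simp only [hub, hva, Finset.sum_const_zero] at h₁ h₂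
  have hs := Finset.sum_le_sum fun k (_ : k ∈ Finset.univ) => hua k
  have hs' : ∑ k, ((if i = k then 1 else 0) + if j = k then 1 else 0) = 2 := by
    simp [Finset.sum_add_distrib]
  -- The `a`-total of `u` is at least two by the degree equations and at most two by `hua`, so every
  -- bound in `hua` is attained.
  have ha k := (Finset.sum_eq_sum_iff_of_le fun k (_ : k ∈ Finset.univ) => hua k).mp
    (by omega) k (Finset.mem_univ k)
  refine ⟨leftExp_le (fun k => (ha k).ge) (by omega) (by omega) (by omega),
    rightExp_le (fun k => ?_) (by omega) (by omega) (by omega)⟩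
  rw [← ha k]
  simpa [hub, hva] using (h₃ k).le

theorem isPrimitiveBinomial_of_mem_family {p : MvPolynomial (graphG t).edgeSet K}
    (hp : p ∈ family K t) : IsPrimitiveBinomial (toricIdeal K (graphG t)) p := by
  rcases mem_family_iff.mp hp with ⟨i, j, hij, rfl⟩ | ⟨i, j, -, rfl⟩
  · exact isPrimitiveBinomial_square hij.ne
  · exact isPrimitiveBinomial_left_sub_right i j

end GraphG

end ToricGraph

end

theorem mainTheorem6 (K : Type*) [Field K] (t : ℕ) (ht : 2 ≤ t) :
    ToricGraph.toricIdeal K (ToricGraph.graphG t) = Ideal.span (ToricGraph.family K t) ∧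
    (∀ p : MvPolynomial (ToricGraph.graphG t).edgeSet K,
      ToricGraph.IsPrimitiveBinomial (ToricGraph.toricIdeal K (ToricGraph.graphG t)) p ↔
        p ∈ ToricGraph.family K t ∨ -p ∈ ToricGraph.family K t) ∧
    ToricGraph.IsUniversalGroebnerBasis (ToricGraph.family K t)
      (ToricGraph.toricIdeal K (ToricGraph.graphG t)) := by
  have hsub := ToricGraph.family_subset_toricIdeal (K := K) (t := t)
  have hconf := ToricGraph.isConformal_family (K := K) (t := t)
  refine ⟨hconf.toricIdeal_eq_span hsub,
    fun p => ⟨hconf.mem_of_isPrimitiveBinomial hsub, fun h => ?_⟩,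
    hconf.isUniversalGroebnerBasis ToricGraph.family_finite hsub⟩
  rcases h with h | h
  · exact ToricGraph.isPrimitiveBinomial_of_mem_family h
  · rw [← neg_neg p]
    exact (ToricGraph.isPrimitiveBinomial_of_mem_family h).neg
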